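/- Let $p$ be a prime, let $n\ge 1$, and let $K/F$ be a cyclic extension of fields of degree $p^n$ with $\mathrm{Gal}(K/F)=\langle\sigma\rangle$, where $F$ contains a primitive $p$-th root of unity $\xi_p$ (so $\operatorname{char}F\neq p$). Let $A=(K/F,\sigma,\xi_p)=\bigoplus_{0\le j<p^n}u^jK$ be the cyclic algebra with multiplication determined by $u^{-1}du=\sigma(d)$ for $d\in K$ and $u^{p^n}=\xi_p$. Suppose that $A$ is a division algebra. In an extension field of $K$, let $\xi_{p^i}$ be a primitive $p^i$-th root of unity for $1\le i\le n$, and put $F_i=F(\xi_{p^i})$, $L_i=K(\xi_{p^i})$ and $A_i=A\otimes_F F_i$. For a cyclic extension $L/E$ of degree a power $p^r$ of $p$, with $\xi_p\in E$, let $E_s$ $(0\le s\le r)$ be the intermediate field with $[E_s:E]=p^s$, and define $m(L/E)=-\infty$ if $\xi_p\in N_{L/E}(L^\times)$ and $m(L/E)=\min\{s:\xi_p\in N_{L/E_s}(L^\times)\}-1$ otherwise. For a finite-dimensional central simple $E$-algebra $B\cong M_s(D)$, with $D$ a division algebra, let $\operatorname{ind}B=\sqrt{\dim_E D}$. Then for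 every $i=1,\dots,n$: one has $F_i\subseteq F_n$, and $L_i$ is linearly disjoint from $F_n$ over $F_i$; the extension $L_i/F_i$ is cyclic of degree $p^n$ (in particular $m(L_i/F_i)$ is defined); $m(L_i/F_i)\neq-\infty$; and $$\operatorname{ind}A_i=p^{m(L_i/F_i)+1}=p^{n-i+1}.$$ -/

import Mathlib

open scoped TensorProduct

section CyclicAlgebra

variable {F K : Type*} [Field F] [Field K] [Algebra F K]

/-- The underlying space of the cyclic algebra `(K/F, σ, b)`: the family `x` stands for the sum of
the `u ^ j * x j` over `0 ≤ j < r`, where `r` is the order of `σ` (and `r = [K : F]` when `K/F` is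
Galois with group generated by `σ`). The product defined below is determined by
`d * u = u * σ d` for `d` in `K`, and `u ^ r = b`. -/
def CyclicAlgebra (σ : K ≃ₐ[F] K) (_b : F) : Type _ := Fin (orderOf σ) → K

namespace CyclicAlgebra

variable (σ : K ≃ₐ[F] K) (b : F)

noncomputable instance : AddCommGroup (CyclicAlgebra σ b) :=
  inferInstanceAs (AddCommGroup (Fin (orderOf σ) → K))

noncomputable instance : Module F (CyclicAlgebra σ b) :=
  inferInstanceAs (Module F (Fin (orderOf σ) → K))

/-- `(u ^ i * x) * (u ^ j * y) = u ^ (i + j) * (σ ^ j) x * y`, where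
`u ^ (i + j) = u ^ ((i + j) % r) * b ^ ((i + j) / r)`. -/
noncomputable instance : Mul (CyclicAlgebra σ b) where
  mul x y := fun k => ∑ i : Fin (orderOf σ), ∑ j : Fin (orderOf σ),
    if ((i : ℕ) + j) % orderOf σ = k then
      algebraMap F K b ^ (((i : ℕ) + j) / orderOf σ) * (σ ^ (j : ℕ)) (x i) * y j
    else 0

/-- The unit element is `u ^ 0 * 1`. -/
noncomputable instance : One (CyclicAlgebra σ b) where
  one := fun k => if (k : ℕ) = 0 then 1 else 0

variable {σ b}

/-- The element `u ^ j * d`, for `0 ≤ j < r`. -/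
noncomputable def single (j : Fin (orderOf σ)) (d : K) : CyclicAlgebra σ b :=
  Pi.single (M := fun _ => K) j d

theorem add_apply (x y : CyclicAlgebra σ b) (k : Fin (orderOf σ)) : (x + y) k = x k + y k := rfl

theorem smul_apply (c : F) (x : CyclicAlgebra σ b) (k : Fin (orderOf σ)) :
    (c • x) k = c • x k := rfl

theorem zero_apply (k : Fin (orderOf σ)) : (0 : CyclicAlgebra σ b) k = 0 := rfl

theorem mul_apply (x y : CyclicAlgebra σ b) (k : Fin (orderOf σ)) :
    (x * y) k = ∑ i : Fin (orderOf σ), ∑ j : Fin (orderOf σ),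
      if ((i : ℕ) + j) % orderOf σ = k then
        algebraMap F K b ^ (((i : ℕ) + j) / orderOf σ) * (σ ^ (j : ℕ)) (x i) * y j
      else 0 := rfl

theorem one_apply (k : Fin (orderOf σ)) :
    (1 : CyclicAlgebra σ b) k = if (k : ℕ) = 0 then 1 else 0 := rfl

@[ext]
theorem ext {x y : CyclicAlgebra σ b} (h : ∀ k, x k = y k) : x = y := funext h

theorem single_apply (j k : Fin (orderOf σ)) (d : K) :
    (single j d : CyclicAlgebra σ b) k = if (j : ℕ) = k then d else 0 := by
  simp [single, Pi.single_apply, Fin.ext_iff, eq_comm]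

theorem add_mul' (x y z : CyclicAlgebra σ b) : (x + y) * z = x * z + y * z := by
  ext k
  simp only [mul_apply, add_apply, map_add, ← Finset.sum_add_distrib]
  refine Finset.sum_congr rfl fun i _ => Finset.sum_congr rfl fun j _ => ?_
  split_ifs <;> ring

theorem mul_add' (x y z : CyclicAlgebra σ b) : x * (y + z) = x * y + x * z := by
  ext k
  simp only [mul_apply, add_apply, ← Finset.sum_add_distrib]
  refine Finset.sum_congr rfl fun i _ => Finset.sum_congr rfl fun j _ => ?_
  split_ifs <;> ring

theorem single_mul_single (i j : Fin (orderOf σ)) (x y : K) :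
    (single i x * single j y : CyclicAlgebra σ b) =
      single ⟨((i : ℕ) + j) % orderOf σ, Nat.mod_lt _ i.pos⟩
        (algebraMap F K b ^ (((i : ℕ) + j) / orderOf σ) * (σ ^ (j : ℕ)) x * y) := by
  ext k
  rw [mul_apply, single_apply, Finset.sum_eq_single i, Finset.sum_eq_single j]
  · simp [single_apply]
  · intro l _ hl
    have : (j : ℕ) ≠ l := fun h => hl (Fin.ext h.symm)
    simp [single_apply, this]
  · simp
  · intro l _ hl
    have : (i : ℕ) ≠ l := fun h => hl (Fin.ext h.symm)
    simp [single_apply, this]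
  · simp

/-- The product as a biadditive map. -/
noncomputable def mulHom : CyclicAlgebra σ b →+ CyclicAlgebra σ b →+ CyclicAlgebra σ b :=
  AddMonoidHom.mk' (fun x => AddMonoidHom.mk' (fun y => x * y) (mul_add' x))
    fun x y => by ext1 z; exact add_mul' x y z

theorem induction_single {P : CyclicAlgebra σ b → Prop} (h0 : P 0)
    (hadd : ∀ x y, P x → P y → P (x + y)) (hs : ∀ j d, P (single j d)) (x : CyclicAlgebra σ b) :
    P x := by
  have hx : x = ∑ j, single j (x j) := (Finset.univ_sum_single (M := fun _ => K) x).symm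
  rw [hx]
  exact Finset.sum_induction _ P hadd h0 fun j _ => hs j _

theorem zero_mul' (x : CyclicAlgebra σ b) : 0 * x = 0 :=
  DFunLike.congr_fun (map_zero mulHom) x

theorem mul_zero' (x : CyclicAlgebra σ b) : x * 0 = 0 := map_zero (mulHom x)

theorem mul_assoc' (x y z : CyclicAlgebra σ b) : x * y * z = x * (y * z) := by
  induction x using induction_single with
  | h0 => simp only [zero_mul']
  | hadd x x' hx hx' => simp only [add_mul', hx, hx']
  | hs i x =>
  induction y using induction_single with
  | h0 => simp only [zero_mul', mul_zero']
  | hadd y y' hy hy' => simp only [add_mul', mul_add', hy, hy']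
  | hs j y =>
  induction z using induction_single with
  | h0 => simp only [mul_zero']
  | hadd z z' hz hz' => simp only [mul_add', hz, hz']
  | hs k z =>
  have hr : 0 < orderOf σ := i.pos
  have carry : ∀ m l : ℕ, m / orderOf σ + (m % orderOf σ + l) / orderOf σ
      = (m + l) / orderOf σ := fun m l => by
    conv_rhs => rw [← Nat.mod_add_div m (orderOf σ), add_right_comm, Nat.add_mul_div_left _ _ hr]
    exact add_comm _ _
  simp only [single_mul_single]
  congr 1
  · simp [add_assoc]
  · simp only [map_mul, map_pow, AlgEquiv.commutes, pow_mod_orderOf]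
    have h1 := carry (i + j) k
    have h2 := carry (j + k) i
    rw [add_comm ((j : ℕ) + k) i, ← add_assoc, ← h1, add_comm (((j : ℕ) + k) % orderOf σ) _] at h2
    have h3 : (σ ^ (k : ℕ)) ((σ ^ (j : ℕ)) x) = (σ ^ ((j : ℕ) + k)) x := by
      rw [add_comm, pow_add, AlgEquiv.mul_apply]
    have h4 := congrArg (algebraMap F K b ^ ·) h2
    simp only [pow_add] at h4
    rw [h3]
    linear_combination (-((σ ^ ((j : ℕ) + k)) x * (σ ^ (k : ℕ)) y * z)) * h4

theorem one_eq_single [FiniteDimensional F K] :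
    (1 : CyclicAlgebra σ b) = single ⟨0, orderOf_pos σ⟩ 1 := by
  ext k
  simp [one_apply, single_apply, eq_comm]

theorem one_mul' [FiniteDimensional F K] (x : CyclicAlgebra σ b) : 1 * x = x := by
  induction x using induction_single with
  | h0 => exact mul_zero' _
  | hadd x y hx hy => rw [mul_add', hx, hy]
  | hs j d =>
    rw [one_eq_single, single_mul_single]
    congr 1
    · ext; simp [Nat.mod_eq_of_lt j.2]
    · simp [Nat.div_eq_of_lt j.2]

theorem mul_one' [FiniteDimensional F K] (x : CyclicAlgebra σ b) : x * 1 = x := by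
  induction x using induction_single with
  | h0 => exact zero_mul' _
  | hadd x y hx hy => rw [add_mul', hx, hy]
  | hs j d =>
    rw [one_eq_single, single_mul_single]
    congr 1
    · ext; simp [Nat.mod_eq_of_lt j.2]
    · simp [Nat.div_eq_of_lt j.2]

variable (σ b)

noncomputable instance [FiniteDimensional F K] : Ring (CyclicAlgebra σ b) :=
  { (inferInstance : AddCommGroup (CyclicAlgebra σ b)),
    (inferInstance : Mul (CyclicAlgebra σ b)),
    (inferInstance : One (CyclicAlgebra σ b)) with
    left_distrib := mul_add'
    right_distrib := add_mul'
    zero_mul := zero_mul'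
    mul_zero := mul_zero'
    mul_assoc := mul_assoc'
    one_mul := one_mul'
    mul_one := mul_one' }

noncomputable instance [FiniteDimensional F K] : Algebra F (CyclicAlgebra σ b) :=
  Algebra.ofModule
    (fun c x y => by
      ext k
      simp only [mul_apply, smul_apply, map_smul, Finset.smul_sum]
      refine Finset.sum_congr rfl fun i _ => Finset.sum_congr rfl fun j _ => ?_
      split_ifs <;> simp [Algebra.smul_def]; ring)
    (fun c x y => by
      ext k
      simp only [mul_apply, smul_apply, Finset.smul_sum]
      refine Finset.sum_congr rfl fun i _ => Finset.sum_congr rfl fun j _ => ?_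
      split_ifs <;> simp [Algebra.smul_def]; ring)

end CyclicAlgebra

end CyclicAlgebra

/-- A ring is a division ring: it is nontrivial and every nonzero element is invertible. -/
def IsDivision (A : Type*) [Ring A] : Prop :=
  Nontrivial A ∧ ∀ x : A, x ≠ 0 → IsUnit x

/-- The Schur index of a finite-dimensional central simple `E`-algebra `B`: the natural number `d` with
`d ^ 2 = dim_E D`, where `D` is the division `E`-algebra with `B ≃ M_s(D)` for some `s ≥ 1`
(by Wedderburn's theorem there is exactly one such `d`). -/
noncomputable def schurIndex.{u, v} (E : Type u) [Field E] (B : Type v) [Ring B] [Algebra E B] : ℕ :=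
  sInf {d : ℕ | ∃ (s : ℕ) (D : Type v) (_ : DivisionRing D) (_ : Algebra E D),
    s ≠ 0 ∧ Nonempty (B ≃ₐ[E] Matrix (Fin s) (Fin s) D) ∧ Module.finrank E D = d ^ 2}

/-- `b` is the norm, from `K` to the intermediate field `T`, of a nonzero element of `K`. -/
def IsNormTo {F K : Type*} [Field F] [Field K] [Algebra F K] (T : IntermediateField F K)
    (b : F) : Prop :=
  ∃ y : Kˣ, Algebra.norm T (y : K) = algebraMap F T b

open Classical in
/-- The invariant `m(K/F)` of a cyclic extension `K/F` of degree a power of `p`, where `ξ` is a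
primitive `p`-th root of unity in `F`: it is `-∞` if `ξ` is a norm from `K` to `F`, and otherwise
one less than the least `s` such that `ξ` is a norm from `K` to the subextension `K_s` with
`[K_s : F] = p ^ s`. That least `s` is then positive, since `K_0 = F`. -/
noncomputable def mInvariant (p : ℕ) (F K : Type*) [Field F] [Field K] [Algebra F K] (ξ : F) :
    WithBot ℕ :=
  if ∃ y : Kˣ, Algebra.norm F (y : K) = ξ then ⊥
  else ((sInf {s : ℕ | ∃ T : IntermediateField F K,
    Module.finrank F T = p ^ s ∧ IsNormTo T ξ} - 1 : ℕ) : WithBot ℕ)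

section Compositum

variable (F K : Type*) {Ω : Type*} [Field F] [Field K] [Field Ω] [Algebra F K] [Algebra F Ω]
  [Algebra K Ω] [IsScalarTower F K Ω]

theorem adjoin_le_restrictScalars_adjoin (z : Ω) :
    IntermediateField.adjoin F {z} ≤ (IntermediateField.adjoin K {z}).restrictScalars F := by
  rw [IntermediateField.adjoin_le_iff, Set.singleton_subset_iff]
  exact IntermediateField.mem_adjoin_simple_self K z

/-- The field `K(z)`, as an extension of `F(z)`. -/
noncomputable def adjoinOver (z : Ω) : IntermediateField (IntermediateField.adjoin F {z}) Ω :=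
  IntermediateField.extendScalars (adjoin_le_restrictScalars_adjoin F K z)

end Compositum

/-!
The index of the cyclic algebra `A = (K/F, σ, ξ)` after a scalar extension is controlled by modules
of small dimension, so that no Brauer group is needed.

Let `T ⊇ F` be a field and `L = KT`. If `ξ` is the norm of some `y` from `L` to `T`, then `A` acts
`T`-linearly on a nonzero `T`-space `V` of dimension at most `p ^ n`, the degree of `A`. With
`t = p ^ n / [L : T]` and `τ` the generator of `Gal(L/T)` restricting to `σ⁻¹ ^ t` on `K`, the space
`V` consists of the sequences `v : ℕ → L` with `v (j + t) = y * τ (v j)`; the element `u` acts as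
the shift, `d ∈ K` multiplies the `j`-th term by `σ⁻¹ ^ j (d)`, and `u ^ (p ^ n)` acts as the product
of the conjugates of `y`, that is, as `ξ`
(`twistedSequences.representation`, `exists_representation_of_norm_eq`). A nonzero module over the
division algebra `A` has `F`-dimension at least `p ^ (2 * n)`, hence `[T : F] ≥ p ^ n`
(`orderOf_le_finrank_of_norm_eq`).

Let `E = F(ζ)` with `ζ` a primitive `p ^ i`-th root of unity, and `L = KE`. Then `[E : F]` is at most
`p ^ (i - 1)`, and some `z ∈ E` satisfies `z ^ p ^ (i - 1) = ξ`, so that `ξ` is the norm of `z` from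
`L` to every subfield of codegree `p ^ (i - 1)`. The inequality above, applied to such a subfield,
leaves no room: `[L : E] = p ^ n` and `[E : F] = p ^ (i - 1)` (`finrank_eq_of_pow_eq`). The
invariant `m` is read off from the same inequality (`mInvariant_eq`). Linear disjointness follows by
comparing degrees (`linearDisjoint_adjoinOver`).

For the index, `E ⊗ A` is simple because `A` is a central division algebra
(`isSimpleRing_tensorProduct`), so it is some `M_s(D)`. Its simple module `D ^ s` is a nonzero
`A`-module, which bounds the index from below; the space `V` of a subfield `T` of codegree
`p ^ (i - 1)` is a nonzero module over `E ⊗ A` and so contains a copy of `D ^ s`, which bounds the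
index from above (`schurIndex_eq`).
-/

/-! ### Representations of a cyclic algebra -/

namespace CyclicAlgebra

variable {F K : Type*} [Field F] [Field K] [Algebra F K] {σ : K ≃ₐ[F] K} {b : F}

section Lift

variable {B : Type*} [Ring B] [Algebra F B]

theorem mul_pow_eq_pow_mul (ρ : K →ₐ[F] B) (U : B) (hU : ∀ d, ρ d * U = U * ρ (σ d)) (j : ℕ)
    (d : K) : ρ d * U ^ j = U ^ j * ρ ((σ ^ j) d) := by
  induction j generalizing d with
  | zero => simp
  | succ j ih =>
    rw [pow_succ, ← mul_assoc, ih, mul_assoc, hU, ← mul_assoc, pow_succ', AlgEquiv.mul_apply]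

/-- The universal property of the cyclic algebra: a representation `ρ` of `K` and an element `U`
satisfying the defining relations of `u` extend to the whole algebra. -/
noncomputable def lift [FiniteDimensional F K] (ρ : K →ₐ[F] B) (U : B)
    (hU : ∀ d, ρ d * U = U * ρ (σ d))
    (hb : U ^ orderOf σ = algebraMap F B b) : CyclicAlgebra σ b →ₐ[F] B := by
  let f : CyclicAlgebra σ b →ₗ[F] B :=
    { toFun := fun x => ∑ j : Fin (orderOf σ), U ^ (j : ℕ) * ρ (x j)
      map_add' := fun x y => by simp only [add_apply, map_add, mul_add, Finset.sum_add_distrib]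
      map_smul' := fun c x => by
        simp only [smul_apply, map_smul, mul_smul_comm, Finset.smul_sum, RingHom.id_apply] }
  have fs : ∀ (j : Fin (orderOf σ)) (d : K), f (single j d) = U ^ (j : ℕ) * ρ d := fun j d => by
    change ∑ k : Fin (orderOf σ), U ^ (k : ℕ) * ρ ((single j d : CyclicAlgebra σ b) k) = _
    rw [Finset.sum_eq_single (j : Fin (orderOf σ))]
    · simp [single_apply]
    · intro k _ hk
      have : (j : ℕ) ≠ k := fun h => hk (Fin.ext h.symm)
      simp [single_apply, this]
    · simp
  refine AlgHom.ofLinearMap f ?_ fun x y => ?_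
  · rw [one_eq_single, fs]; simp
  · induction x using induction_single with
    | h0 => simp
    | hadd x x' hx hx' => simp only [add_mul, map_add, hx, hx']
    | hs i x =>
    induction y using induction_single with
    | h0 => simp
    | hadd y y' hy hy' => simp only [mul_add, map_add, hy, hy']
    | hs j y =>
    rw [single_mul_single, fs, fs, fs, mul_assoc (U ^ (i : ℕ)), ← mul_assoc (ρ x),
      mul_pow_eq_pow_mul ρ U hU, ← mul_assoc, ← mul_assoc, ← pow_add, map_mul, map_mul, map_pow,
      AlgHom.commutes]
    conv_rhs => rw [← Nat.mod_add_div ((i : ℕ) + j) (orderOf σ), pow_add, pow_mul, hb]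
    simp only [mul_assoc]

end Lift

variable [FiniteDimensional F K]

instance : FiniteDimensional F (CyclicAlgebra σ b) :=
  inferInstanceAs (FiniteDimensional F (Fin (orderOf σ) → K))

theorem finrank_eq : Module.finrank F (CyclicAlgebra σ b) = orderOf σ * Module.finrank F K := by
  change Module.finrank F (Fin (orderOf σ) → K) = _
  simp [Module.finrank_pi_fintype]

/-- The center of a cyclic algebra is `F`: an element commuting with `K` lies in `K`, and one
commuting with `u` as well is fixed by `σ`. -/
theorem exists_algebraMap_eq_of_forall_commute [IsGalois F K] (hσ : ∀ τ : K ≃ₐ[F] K,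
    τ ∈ Subgroup.zpowers σ) (x : CyclicAlgebra σ b)
    (hx : ∀ y, y * x = x * y) : ∃ c, algebraMap F (CyclicAlgebra σ b) c = x := by
  have hr := orderOf_pos σ
  have hl : ∀ (d : K) (k : Fin (orderOf σ)),
      ((single ⟨0, hr⟩ d : CyclicAlgebra σ b) * x) k = (σ ^ (k : ℕ)) d * x k := by
    intro d k
    rw [mul_apply, Finset.sum_eq_single ⟨0, hr⟩, Finset.sum_eq_single k]
    · simp [single_apply, Nat.mod_eq_of_lt k.2, Nat.div_eq_of_lt k.2]
    · intro l _ hlk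
      have : (l : ℕ) ≠ k := fun h => hlk (Fin.ext h)
      simp [Nat.mod_eq_of_lt l.2, this]
    · simp
    · intro l _ hl
      have : 0 ≠ (l : ℕ) := fun h => hl (Fin.ext h.symm)
      simp [single_apply, this]
    · simp
  have hrr : ∀ (d : K) (k : Fin (orderOf σ)),
      (x * (single ⟨0, hr⟩ d : CyclicAlgebra σ b)) k = x k * d := by
    intro d k
    rw [mul_apply, Finset.sum_eq_single k, Finset.sum_eq_single ⟨0, hr⟩]
    · simp [single_apply, Nat.mod_eq_of_lt k.2, Nat.div_eq_of_lt k.2]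
    · intro l _ hl
      have : 0 ≠ (l : ℕ) := fun h => hl (Fin.ext h.symm)
      simp [single_apply, this]
    · simp
    · intro l _ hlk
      have : (l : ℕ) ≠ k := fun h => hlk (Fin.ext h)
      refine Finset.sum_eq_zero fun m _ => ?_
      by_cases hm : 0 = (m : ℕ)
      · simp [← hm, Nat.mod_eq_of_lt l.2, this]
      · simp [single_apply, hm]
    · simp
  -- Commuting with `d ∈ K` gives `σ ^ k (d) * x k = x k * d`.
  have h0 : ∀ k : Fin (orderOf σ), (k : ℕ) ≠ 0 → x k = 0 := by
    intro k hk
    by_contra hxk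
    have : σ ^ (k : ℕ) = 1 := by
      ext d
      have h1 := congrFun (hx (single ⟨0, hr⟩ d)) k
      rw [hl, hrr, mul_comm] at h1
      exact mul_left_cancel₀ hxk h1
    exact absurd (orderOf_dvd_of_pow_eq_one this) (Nat.not_dvd_of_pos_of_lt (by omega) k.2)
  have hxs : x = single ⟨0, hr⟩ (x ⟨0, hr⟩) := by
    ext k
    by_cases hk : (k : ℕ) = 0
    · have : k = ⟨0, hr⟩ := Fin.ext hk
      subst this; simp [single_apply]
    · simp [single_apply, Ne.symm hk, h0 k hk]
  have hfix : σ (x ⟨0, hr⟩) = x ⟨0, hr⟩ := by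
    by_cases h1 : orderOf σ = 1
    · rw [orderOf_eq_one_iff] at h1; simp [h1]
    · have h2 : 1 < orderOf σ := by omega
      have h3 := congrFun (hx (single ⟨1, h2⟩ 1)) ⟨1, h2⟩
      rw [hxs, single_mul_single, single_mul_single] at h3
      change (single _ _ : CyclicAlgebra σ b) _ = (single _ _ : CyclicAlgebra σ b) _ at h3
      simpa [single_apply, Nat.mod_eq_of_lt h2, Nat.div_eq_of_lt h2] using h3.symm
  obtain ⟨c, hc⟩ : x ⟨0, hr⟩ ∈ Set.range (algebraMap F K) := by
    rw [IsGalois.mem_range_algebraMap_iff_fixed]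
    intro τ
    have : Subgroup.zpowers σ ≤ MulAction.stabilizer (K ≃ₐ[F] K) (x ⟨0, hr⟩) := by
      rw [Subgroup.zpowers_le]; exact hfix
    exact this (hσ τ)
  refine ⟨c, ?_⟩
  rw [Algebra.algebraMap_eq_smul_one, hxs, ← hc]
  ext k
  simp [smul_apply, one_apply, single_apply, Algebra.smul_def, eq_comm]

end CyclicAlgebra

section Representation

variable {F K T L : Type*} [Field F] [Field K] [Field T] [Field L] [Algebra F K] [Algebra F T]
  [Algebra T L] [Algebra K L]

/-- The `T`-space of the sequences `v` with `v (j + t) = y * τ (v j)`. It is isomorphic to `L ^ t`;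
with sequences indexed by `ℕ`, the operator moving the terms along is a plain shift. -/
def twistedSequences (τ : L ≃ₐ[T] L) (y : L) (t : ℕ) : Submodule T (ℕ → L) where
  carrier := {v | ∀ j, v (j + t) = y * τ (v j)}
  add_mem' := fun hv hw j => by simp [hv j, hw j, mul_add]
  zero_mem' := fun j => by simp
  smul_mem' := fun c v hv j => by simp [hv j]

namespace twistedSequences

variable {τ : L ≃ₐ[T] L} {y : L} {t : ℕ}

/-- The first `t` terms of a sequence, which determine it. -/
def restrict (τ : L ≃ₐ[T] L) (y : L) (t : ℕ) : twistedSequences τ y t →ₗ[T] (Fin t → L) where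
  toFun v j := v.1 j
  map_add' _ _ := rfl
  map_smul' _ _ := rfl

theorem restrict_injective (ht : 0 < t) : Function.Injective (restrict τ y t) := by
  intro v w h
  ext j
  induction j using Nat.strong_induction_on with
  | _ j ih =>
  by_cases hj : j < t
  · exact congrFun h ⟨j, hj⟩
  · obtain ⟨k, rfl⟩ := Nat.exists_eq_add_of_le' (not_lt.1 hj)
    rw [v.2, w.2, ih k (by omega)]

theorem finite [FiniteDimensional T L] (ht : 0 < t) :
    FiniteDimensional T (twistedSequences τ y t) :=
  Module.Finite.of_injective _ (restrict_injective ht)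

theorem finrank_le [FiniteDimensional T L] (ht : 0 < t) :
    Module.finrank T (twistedSequences τ y t) ≤ t * Module.finrank T L := by
  simpa [Module.finrank_pi_fintype] using
    LinearMap.finrank_le_finrank_of_injective (restrict_injective (τ := τ) (y := y) ht)

theorem nontrivial (ht : 0 < t) : Nontrivial (twistedSequences τ y t) := by
  refine ⟨⟨⟨fun j => (fun x => y * τ x)^[j / t] (if j % t = 0 then 1 else 0), fun j => ?_⟩, 0,
    fun h => ?_⟩⟩
  · simp only [Nat.add_div_right j ht, Nat.add_mod_right, Function.iterate_succ_apply']
  · have := congrFun (congrArg Subtype.val h) 0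
    simp at this

/-- The shift of sequences. -/
def shift (τ : L ≃ₐ[T] L) (y : L) (t : ℕ) : Module.End T (twistedSequences τ y t) where
  toFun v := ⟨fun j => v.1 (j + 1), fun j => by
    change v.1 (j + t + 1) = _
    rw [add_right_comm]; exact v.2 _⟩
  map_add' _ _ := rfl
  map_smul' _ _ := rfl

theorem shift_pow_apply (m : ℕ) (v : twistedSequences τ y t) (j : ℕ) :
    ((shift τ y t ^ m) v).1 j = v.1 (j + m) := by
  induction m generalizing j with
  | zero => rfl
  | succ m ih =>
    rw [pow_succ', Module.End.mul_apply]
    change ((shift τ y t ^ m) v).1 (j + 1) = _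
    rw [ih, add_right_comm]; rfl

/-- Moving by `t * k` applies the operator `x ↦ y * τ x` to the terms `k` times. -/
theorem apply_add_mul (v : twistedSequences τ y t) (j k : ℕ) :
    v.1 (j + t * k) = (∏ l ∈ Finset.range k, (τ ^ l) y) * (τ ^ k) (v.1 j) := by
  induction k with
  | zero => simp
  | succ k ih =>
    rw [mul_add, mul_one, ← add_assoc, v.2, ih, map_mul, Finset.prod_range_succ', map_prod]
    simp only [pow_succ', AlgEquiv.mul_apply, pow_zero, AlgEquiv.one_apply]
    ring

variable [Algebra F L] [IsScalarTower F K L] [IsScalarTower F T L]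

/-- The action of `K` on the sequences, twisted by `σ⁻¹ ^ j` on the `j`-th term. -/
noncomputable def scalar (σ : K ≃ₐ[F] K) (τ : L ≃ₐ[T] L) (y : L) (t : ℕ)
    (hτ : ∀ d, τ (algebraMap K L d) = algebraMap K L ((σ⁻¹ ^ t) d)) :
    K →ₐ[F] Module.End T (twistedSequences τ y t) where
  toFun d :=
    { toFun := fun v => ⟨fun j => algebraMap K L ((σ⁻¹ ^ j) d) * v.1 j, fun j => by
        change algebraMap K L ((σ⁻¹ ^ (j + t)) d) * v.1 (j + t) =
          y * τ (algebraMap K L ((σ⁻¹ ^ j) d) * v.1 j)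
        rw [v.2, map_mul, hτ, ← AlgEquiv.mul_apply, ← pow_add, add_comm t j]; ring⟩
      map_add' := fun v w => by ext j; simp [mul_add]
      map_smul' := fun c v => by ext j; simp }
  map_one' := by ext v j; simp
  map_mul' d e := by ext v j; simp [mul_assoc]
  map_zero' := by ext v j; simp
  map_add' d e := by ext v j; simp [add_mul]
  commutes' c := by
    ext v j
    simp only [AlgEquiv.commutes, LinearMap.coe_mk, AddHom.coe_mk, ← IsScalarTower.algebraMap_apply,
      Module.algebraMap_end_apply]
    rw [← algebraMap_smul T c v, Submodule.coe_smul, Pi.smul_apply, Algebra.smul_def,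
      ← IsScalarTower.algebraMap_apply]

theorem scalar_apply (σ : K ≃ₐ[F] K) (hτ) (d : K) (v : twistedSequences τ y t) (j : ℕ) :
    (scalar σ τ y t hτ d v).1 j = algebraMap K L ((σ⁻¹ ^ j) d) * v.1 j := rfl

variable [FiniteDimensional F K]

/-- The representation of `(K/F, σ, b)` on the sequences `v` with `v (j + t) = y * τ (v j)`, where
`u` acts by the shift. -/
noncomputable def representation (σ : K ≃ₐ[F] K) (b : F) (τ : L ≃ₐ[T] L) (y : L) (t r : ℕ)
    (htr : t * r = orderOf σ) (hτ : ∀ d, τ (algebraMap K L d) = algebraMap K L ((σ⁻¹ ^ t) d))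
    (hτr : τ ^ r = 1) (hy : ∏ l ∈ Finset.range r, (τ ^ l) y = algebraMap F L b) :
    CyclicAlgebra σ b →ₐ[F] Module.End T (twistedSequences τ y t) :=
  CyclicAlgebra.lift (scalar σ τ y t hτ) (shift τ y t)
    (fun d => by
      ext v j
      simp only [Module.End.mul_apply, scalar_apply]
      change _ * v.1 (j + 1) = (scalar σ τ y t hτ (σ d) v).1 (j + 1)
      rw [scalar_apply, pow_succ, AlgEquiv.mul_apply]
      congr 3
      exact (σ.symm_apply_apply d).symm)
    (by
      ext v j
      rw [shift_pow_apply, ← htr, apply_add_mul, hy, hτr, AlgEquiv.one_apply,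
        Module.algebraMap_end_apply, ← algebraMap_smul T b v, Submodule.coe_smul, Pi.smul_apply,
        Algebra.smul_def, ← IsScalarTower.algebraMap_apply])

end twistedSequences

end Representation

/-! ### Dimensions of modules, and simplicity of a scalar extension -/

section Modules

theorem IsDivision.finrank_le_of_algHom {F A V : Type*} [Field F] [Ring A] [Algebra F A]
    [AddCommGroup V] [Module F V] [FiniteDimensional F V] [Nontrivial V] (hA : IsDivision A)
    (φ : A →ₐ[F] Module.End F V) : Module.finrank F A ≤ Module.finrank F V := by
  obtain ⟨v, hv⟩ := exists_ne (0 : V)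
  refine LinearMap.finrank_le_finrank_of_injective
    (f := (LinearMap.applyₗ v).comp φ.toLinearMap) ?_
  rw [← LinearMap.ker_eq_bot, LinearMap.ker_eq_bot']
  intro a ha
  by_contra h0
  obtain ⟨u, rfl⟩ := hA.2 a h0
  have h1 : φ u v = 0 := ha
  have h2 : φ (↑u⁻¹ * ↑u) v = v := by simp
  rw [map_mul, Module.End.mul_apply, h1, map_zero] at h2
  exact hv h2.symm

/-- A nonzero module over `M_s(D)` contains a copy of the simple module `D ^ s`. -/
theorem Matrix.mul_finrank_le_of_algHom {E D V : Type*} [Field E] [DivisionRing D] [Algebra E D]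
    [AddCommGroup V] [Module E V] [FiniteDimensional E V] [Nontrivial V] {s : ℕ}
    [FiniteDimensional E D]
    (φ : Matrix (Fin s) (Fin s) D →ₐ[E] Module.End E V) :
    s * Module.finrank E D ≤ Module.finrank E V := by
  obtain ⟨v, hv⟩ := exists_ne (0 : V)
  obtain ⟨j, hj⟩ : ∃ j, φ (Matrix.single j j 1) v ≠ 0 := by
    by_contra! h
    have h1 : φ 1 v = v := by simp
    rw [← Matrix.sum_single_one, map_sum, LinearMap.sum_apply,
      Finset.sum_eq_zero fun j _ => h j] at h1
    exact hv h1.symm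
  -- The entries of `x` form the `j`-th column of a matrix; some entry can be moved back to `(j, j)`.
  let f : (Fin s → D) →ₗ[E] V :=
    { toFun := fun x => φ (∑ k, Matrix.single k j (x k)) v
      map_add' := fun x y => by
        simp [Matrix.single_add, Finset.sum_add_distrib]
      map_smul' := fun c x => by
        simp [← Matrix.smul_single, ← Finset.smul_sum] }
  have hf : Function.Injective f := by
    rw [← LinearMap.ker_eq_bot, LinearMap.ker_eq_bot']
    intro x hx
    by_contra h0
    obtain ⟨k, hk⟩ := Function.ne_iff.1 h0
    have h1 : φ (Matrix.single j k (x k)⁻¹) (f x) = φ (Matrix.single j j 1) v := by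
      change φ _ (φ _ v) = _
      rw [← Module.End.mul_apply, ← map_mul, Finset.mul_sum, Finset.sum_eq_single k]
      · rw [Matrix.single_mul_single_same, inv_mul_cancel₀ hk]
      · intro l _ hl
        exact Matrix.single_mul_single_of_ne _ _ _ _ hl.symm _
      · simp
    rw [hx, map_zero] at h1
    exact hj h1.symm
  simpa [Module.finrank_pi_fintype] using LinearMap.finrank_le_finrank_of_injective hf

/-- The simple module `D ^ s` of `E ⊗ A ≃ M_s(D)` is a nonzero module over the division algebra
`A`. -/
theorem Matrix.finrank_le_of_algHom_isDivision {F E A D : Type*} [Field F] [Field E] [Algebra F E]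
    [FiniteDimensional F E] [Ring A] [Algebra F A] [DivisionRing D] [Algebra E D]
    [FiniteDimensional E D] {s : ℕ} (hs : s ≠ 0) (hA : IsDivision A)
    (e : E ⊗[F] A →ₐ[E] Matrix (Fin s) (Fin s) D) :
    Module.finrank F A ≤ Module.finrank F E * (s * Module.finrank E D) := by
  have : NeZero s := ⟨hs⟩
  let _ : Algebra F D := Algebra.compHom D (algebraMap F E)
  have : IsScalarTower F E D := IsScalarTower.of_algebraMap_eq fun _ => rfl
  have : FiniteDimensional F D := FiniteDimensional.trans F E D
  let ψ : A →ₐ[F] Module.End F (Fin s → D) := AlgHom.comp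
    { toFun := fun M =>
        { toFun := fun v => M.mulVec v
          map_add' := fun v w => Matrix.mulVec_add M v w
          map_smul' := fun c v => Matrix.mulVec_smul M c v }
      map_one' := by ext; simp
      map_mul' := fun M N => by ext; simp [← Matrix.mulVec_mulVec]
      map_zero' := by ext; simp
      map_add' := fun M N => by ext; simp [Matrix.add_mulVec]
      commutes' := fun c => by
        ext v
        simp [Algebra.algebraMap_eq_smul_one, Matrix.smul_mulVec] }
    ((e.restrictScalars F).comp Algebra.TensorProduct.includeRight)
  have h := hA.finrank_le_of_algHom ψ
  rwa [Module.finrank_pi_fintype, Finset.sum_const, Finset.card_univ, Fintype.card_fin, smul_eq_mul,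
    ← Module.finrank_mul_finrank F E D, mul_left_comm] at h

end Modules

section Simple

/-- A scalar extension of a central division algebra is simple: an element of a nonzero ideal with
as few nonzero coordinates as possible, one of them `1`, commutes with `A`, so its coordinates are
central and it lies in `E`. -/
theorem isSimpleRing_tensorProduct {F E A : Type*} [Field F] [Field E] [Algebra F E]
    [Ring A] [Algebra F A] (hA : IsDivision A)
    (hc : ∀ x : A, (∀ y, y * x = x * y) → ∃ c, algebraMap F A c = x) :
    IsSimpleRing (E ⊗[F] A) := by
  classical
  have := hA.1
  let b := Module.Basis.ofVectorSpace F E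
  let f := TensorProduct.equivFinsuppOfBasisLeft (N := A) b
  have f_left : ∀ (a : A) (x : E ⊗[F] A) i, f ((1 ⊗ₜ a) * x) i = a * f x i := by
    intro a x i
    induction x using TensorProduct.induction_on with
    | zero => simp
    | tmul e a' => simp [f]
    | add x y hx hy => simp [mul_add, hx, hy]
  have f_right : ∀ (a : A) (x : E ⊗[F] A) i, f (x * (1 ⊗ₜ a)) i = f x i * a := by
    intro a x i
    induction x using TensorProduct.induction_on with
    | zero => simp
    | tmul e a' => simp [f]
    | add x y hx hy => simp [add_mul, hx, hy]
  have : Nontrivial (E ⊗[F] A) := inferInstance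
  refine ⟨⟨fun I => or_iff_not_imp_left.2 fun hI => ?_⟩⟩
  obtain ⟨x0, hx0, hx0'⟩ : ∃ x ∈ I, x ≠ 0 := by
    by_contra! h
    exact hI (le_bot_iff.1 fun x hx => (TwoSidedIdeal.mem_bot _).2 (h x hx))
  have hex : ∃ m, ∃ x ∈ I, x ≠ 0 ∧ (f x).support.card = m := ⟨_, x0, hx0, hx0', rfl⟩
  obtain ⟨x, hxI, hx0, hxm⟩ := Nat.find_spec hex
  have hmin : ∀ z ∈ I, (f z).support ⊂ (f x).support → z = 0 := fun z hz h => by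
    by_contra hz0
    exact Nat.find_min hex (hxm ▸ Finset.card_lt_card h) ⟨z, hz, hz0, rfl⟩
  have hfx : f x ≠ 0 := by simpa using hx0
  obtain ⟨k, hk⟩ := Finsupp.support_nonempty_iff.2 hfx
  obtain ⟨u, hu⟩ := hA.2 _ (Finsupp.mem_support_iff.1 hk)
  set w := (1 ⊗ₜ (↑u⁻¹ : A)) * x with hw
  have hwI : w ∈ I := I.mul_mem_left _ _ hxI
  have hwk : f w k = 1 := by rw [hw, f_left, ← hu, Units.inv_mul]
  have hcomm : ∀ a i, a * f w i = f w i * a := by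
    intro a
    have h0 : (1 ⊗ₜ a) * w - w * (1 ⊗ₜ a) = 0 := by
      refine hmin _ (I.sub_mem (I.mul_mem_left _ _ hwI) (I.mul_mem_right _ _ hwI)) ?_
      rw [Finset.ssubset_iff_of_subset]
      · refine ⟨k, hk, ?_⟩
        simp [f_left, f_right, hwk]
      · intro i hi
        rw [Finsupp.mem_support_iff] at hi ⊢
        contrapose! hi
        have : f w i = 0 := by rw [hw, f_left, hi, mul_zero]
        simp [f_left, f_right, this]
    intro i
    have := congrArg (fun z => f z i) h0
    simpa [f_left, f_right, sub_eq_zero] using this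
  choose c hc using fun i => hc (f w i) (fun a => hcomm a i)
  obtain ⟨e, he⟩ : ∃ e : E, w = e ⊗ₜ 1 := by
    refine ⟨∑ i ∈ (f w).support, c i • b i, ?_⟩
    rw [TensorProduct.sum_tmul]
    have h1 := f.symm_apply_apply w
    rw [TensorProduct.equivFinsuppOfBasisLeft_symm_apply, Finsupp.sum] at h1
    refine h1.symm.trans (Finset.sum_congr rfl fun i _ => ?_)
    rw [← hc, TensorProduct.smul_tmul, Algebra.algebraMap_eq_smul_one]
  have he0 : e ≠ 0 := by
    rintro rfl
    rw [he, TensorProduct.zero_tmul, map_zero] at hwk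
    exact zero_ne_one hwk
  rw [← TwoSidedIdeal.one_mem_iff]
  have := I.mul_mem_left (e⁻¹ ⊗ₜ 1) _ hwI
  rwa [he, Algebra.TensorProduct.tmul_mul_tmul, inv_mul_cancel₀ he0, one_mul,
    ← Algebra.TensorProduct.one_def] at this

end Simple

/-! ### Splitting by norms -/

section CyclicGalois

open IntermediateField

variable {F K T L : Type*} [Field F] [Field K] [Field T] [Field L] [Algebra F K] [Algebra F T]
  [Algebra F L] [Algebra T L] [Algebra K L] [IsScalarTower F K L] [IsScalarTower F T L]
  [FiniteDimensional F K] [IsGalois F K]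

/-- If `L = KT`, then `L/T` is the splitting field of the polynomial of which `K/F` is the splitting
field. -/
theorem isGalois_of_adjoin_range_eq_top (F : Type*) {K T L : Type*} [Field F] [Field K] [Field T]
    [Field L] [Algebra F K] [Algebra F T] [Algebra F L] [Algebra T L] [Algebra K L]
    [IsScalarTower F K L] [IsScalarTower F T L] [FiniteDimensional F K] [IsGalois F K]
    (hgen : adjoin T (Set.range (algebraMap K L)) = ⊤) :
    IsGalois T L ∧ FiniteDimensional T L := by
  obtain ⟨f, hf, hfs⟩ := IsGalois.is_separable_splitting_field F K
  have hs : (f.map (algebraMap F T)).IsSplittingField T L := by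
    rw [isSplittingField_iff_intermediateField]
    constructor
    · rw [Polynomial.map_map, ← IsScalarTower.algebraMap_eq, IsScalarTower.algebraMap_eq F K L,
        ← Polynomial.map_map]
      exact hfs.splits.map _
    · rw [eq_top_iff, ← hgen, adjoin_le_iff]
      rintro _ ⟨x, rfl⟩
      have hx : x ∈ adjoin F (f.rootSet K) := by
        rw [((isSplittingField_iff_intermediateField).1 hfs).2]; trivial
      have hle : adjoin F (f.rootSet K) ≤ ((adjoin T ((f.map (algebraMap F T)).rootSet
          L)).restrictScalars F).comap (IsScalarTower.toAlgHom F K L) := by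
        rw [adjoin_le_iff]
        intro y hy
        refine subset_adjoin T _ ?_
        rw [Polynomial.mem_rootSet'] at hy ⊢
        rw [Polynomial.map_map, ← IsScalarTower.algebraMap_eq, Polynomial.aeval_map_algebraMap]
        refine ⟨(Polynomial.map_ne_zero_iff (algebraMap F L).injective).2 fun h => hy.1 (by simp [h]),
          ?_⟩
        have := Polynomial.aeval_algHom_apply (IsScalarTower.toAlgHom F K L) y f
        rw [hy.2, map_zero] at this
        exact this
      exact hle hx
  exact ⟨IsGalois.of_separable_splitting_field (p := f.map (algebraMap F T)) hf.map,
    hs.finiteDimensional _ _⟩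

variable (F K T L) in
/-- The restriction to `K` of automorphisms of `L` over `T`. -/
noncomputable def restrictGal : (L ≃ₐ[T] L) →* (K ≃ₐ[F] K) :=
  (AlgEquiv.restrictNormalHom K).comp
    (AlgEquiv.restrictScalarsHom F : (L ≃ₐ[T] L) →* (L ≃ₐ[F] L))

omit [FiniteDimensional F K] in
theorem algebraMap_restrictGal (τ : L ≃ₐ[T] L) (d : K) :
    algebraMap K L (restrictGal F K T L τ d) = τ (algebraMap K L d) :=
  AlgEquiv.restrictNormal_commutes (τ.restrictScalars F) K d

omit [FiniteDimensional F K] in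
theorem restrictGal_injective (hgen : adjoin T (Set.range (algebraMap K L)) = ⊤) :
    Function.Injective (restrictGal F K T L) := by
  rw [← MonoidHom.ker_eq_bot_iff, eq_bot_iff]
  have h : adjoin T (Set.range (algebraMap K L)) ≤ fixedField (restrictGal F K T L).ker := by
    rw [adjoin_le_iff]
    rintro _ ⟨d, rfl⟩
    refine (mem_fixedField_iff _ _).2 fun τ hτ => ?_
    rw [← algebraMap_restrictGal (F := F), MonoidHom.mem_ker.1 hτ, AlgEquiv.one_apply]
  intro τ hτ
  rw [Subgroup.mem_bot]
  ext x
  rw [hgen] at h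
  exact (mem_fixedField_iff _ _).1 (h (mem_top (x := x))) τ hτ

theorem adjoin_intermediateField_eq_top {T L : Type*} [Field T] [Field L] [Algebra T L]
    {s : Set L} (hs : adjoin T s = ⊤) (S : IntermediateField T L) : adjoin S s = ⊤ := by
  have h : adjoin T s ≤ (adjoin S s).restrictScalars T :=
    adjoin_le_iff.2 (subset_adjoin S s)
  rw [hs] at h
  exact eq_top_iff.2 fun x _ => h (mem_top (x := x))

variable {σ : K ≃ₐ[F] K}

theorem orderOf_eq_finrank (hσ : ∀ τ : K ≃ₐ[F] K, τ ∈ Subgroup.zpowers σ) :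
    orderOf σ = Module.finrank F K := by
  rw [orderOf_eq_card_of_forall_mem_zpowers hσ, IsGalois.card_aut_eq_finrank]

theorem finrank_dvd_of_adjoin_range_eq_top (hgen : adjoin T (Set.range (algebraMap K L)) = ⊤) :
    Module.finrank T L ∣ Module.finrank F K := by
  obtain ⟨_, _⟩ := isGalois_of_adjoin_range_eq_top F hgen
  rw [← IsGalois.card_aut_eq_finrank, ← IsGalois.card_aut_eq_finrank]
  exact Subgroup.card_dvd_of_injective _ (restrictGal_injective (F := F) hgen)

/-- The image of `Gal(L/T)` in the cyclic group `Gal(K/F)` has index `t`, so it contains the `t`-th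
power of `σ⁻¹`; a preimage has order `[L : T]`. -/
theorem exists_gal_generator (hσ : ∀ τ : K ≃ₐ[F] K, τ ∈ Subgroup.zpowers σ)
    (hgen : adjoin T (Set.range (algebraMap K L)) = ⊤) {t : ℕ}
    (ht : t * Module.finrank T L = orderOf σ) :
    ∃ τ : L ≃ₐ[T] L, (∀ d, τ (algebraMap K L d) = algebraMap K L ((σ⁻¹ ^ t) d)) ∧
      orderOf τ = Module.finrank T L ∧ ∀ g, g ∈ Subgroup.zpowers τ := by
  obtain ⟨_, _⟩ := isGalois_of_adjoin_range_eq_top F hgen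
  have hinj := restrictGal_injective (F := F) hgen
  set ψ := restrictGal F K T L with hψ
  have hcard : Nat.card ψ.range = Module.finrank T L := by
    rw [← IsGalois.card_aut_eq_finrank T L]
    exact (Nat.card_congr (MonoidHom.ofInjective hinj).toEquiv).symm
  have hpos : 0 < Module.finrank T L := Module.finrank_pos
  have hidx : ψ.range.index = t := by
    have := ψ.range.card_mul_index
    rw [hcard, ← orderOf_eq_card_of_forall_mem_zpowers hσ, ← ht, mul_comm] at this
    exact Nat.eq_of_mul_eq_mul_right hpos this
  have : IsCyclic (K ≃ₐ[F] K) := ⟨σ, hσ⟩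
  have : ψ.range.Normal := by
    let _ := IsCyclic.commGroup (α := K ≃ₐ[F] K)
    exact Subgroup.normal_of_isMulCommutative _
  obtain ⟨τ, hτ⟩ : σ⁻¹ ^ t ∈ ψ.range := hidx ▸ Subgroup.pow_index_mem ψ.range σ⁻¹
  have ho : orderOf τ = Module.finrank T L := by
    have htpos : t ≠ 0 := by
      rintro rfl
      rw [zero_mul] at ht
      exact (orderOf_pos σ).ne ht
    rw [← orderOf_injective ψ hinj τ, hτ, orderOf_pow_of_dvd htpos (by rw [orderOf_inv, ← ht]; simp),
      orderOf_inv, ← ht, Nat.mul_div_cancel_left _ (Nat.pos_of_ne_zero htpos)]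
  refine ⟨τ, fun d => ?_, ho, fun g => ?_⟩
  · rw [← hτ, hψ, algebraMap_restrictGal]
  · have : Subgroup.zpowers τ = ⊤ := by
      apply Subgroup.eq_top_of_card_eq
      rw [Nat.card_zpowers, ho, IsGalois.card_aut_eq_finrank]
    rw [this]; trivial

theorem prod_pow_generator_eq_norm [FiniteDimensional T L] [IsGalois T L] {τ : L ≃ₐ[T] L}
    (hτ : ∀ g, g ∈ Subgroup.zpowers τ) (y : L) :
    ∏ l ∈ Finset.range (orderOf τ), (τ ^ l) y = algebraMap T L (Algebra.norm T y) := by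
  classical
  rw [Algebra.norm_eq_prod_automorphisms, ← IsCyclic.image_range_orderOf hτ, Finset.prod_image]
  intro a ha b hb h
  exact pow_injOn_Iio_orderOf (by simpa using ha) (by simpa using hb) h

/-- If `b` is a norm from `L = KT` to `T`, then `T` splits `(K/F, σ, b)`: the algebra acts
`T`-linearly on a nonzero `T`-space of dimension at most its degree. -/
theorem exists_representation_of_norm_eq (hσ : ∀ τ : K ≃ₐ[F] K, τ ∈ Subgroup.zpowers σ)
    (hgen : adjoin T (Set.range (algebraMap K L)) = ⊤) {b : F} {y : L}
    (hy : Algebra.norm T y = algebraMap F T b) :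
    ∃ V : Submodule T (ℕ → L), FiniteDimensional T V ∧ Nontrivial V ∧
      Module.finrank T V ≤ orderOf σ ∧
      Nonempty (CyclicAlgebra σ b →ₐ[F] Module.End T V) := by
  obtain ⟨_, _⟩ := isGalois_of_adjoin_range_eq_top F hgen
  obtain ⟨t, ht⟩ := finrank_dvd_of_adjoin_range_eq_top (F := F) hgen
  rw [← orderOf_eq_finrank hσ, mul_comm] at ht
  have htpos : 0 < t := by
    rcases Nat.eq_zero_or_pos t with rfl | h
    · rw [zero_mul] at ht
      exact absurd ht (orderOf_pos σ).ne'
    · exact h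
  obtain ⟨τ, hτ, ho, hg⟩ := exists_gal_generator hσ hgen ht.symm
  refine ⟨twistedSequences τ y t, twistedSequences.finite htpos, twistedSequences.nontrivial htpos,
    ht ▸ twistedSequences.finrank_le htpos, ⟨twistedSequences.representation σ b τ y t
      (Module.finrank T L) ht.symm hτ (ho ▸ pow_orderOf_eq_one τ) ?_⟩⟩
  rw [← ho, prod_pow_generator_eq_norm hg, hy, ← IsScalarTower.algebraMap_apply]

/-- Linear maps over `T` as linear maps over a smaller field. -/
def endRestrictScalars (F E : Type*) {T V : Type*} [Field F] [Field E] [Field T] [Algebra F E]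
    [Algebra F T] [Algebra E T] [IsScalarTower F E T] [AddCommGroup V] [Module F V] [Module E V]
    [Module T V] [IsScalarTower F T V] [IsScalarTower E T V] [IsScalarTower F E V] :
    Module.End T V →ₐ[F] Module.End E V where
  toFun f := f.restrictScalars E
  map_one' := rfl
  map_mul' _ _ := rfl
  map_zero' := rfl
  map_add' _ _ := rfl
  commutes' _ := rfl

/-- A field splitting a division algebra has degree at least that of the algebra. -/
theorem orderOf_le_finrank_of_norm_eq (hσ : ∀ τ : K ≃ₐ[F] K, τ ∈ Subgroup.zpowers σ)
    [FiniteDimensional F T] {b : F} (hA : IsDivision (CyclicAlgebra σ b))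
    (hgen : adjoin T (Set.range (algebraMap K L)) = ⊤) {y : L}
    (hy : Algebra.norm T y = algebraMap F T b) : orderOf σ ≤ Module.finrank F T := by
  obtain ⟨V, _, _, hV, ⟨φ⟩⟩ := exists_representation_of_norm_eq hσ hgen hy
  have : FiniteDimensional F V := FiniteDimensional.trans F T V
  have h := hA.finrank_le_of_algHom ((endRestrictScalars F F).comp φ)
  rw [CyclicAlgebra.finrank_eq, ← orderOf_eq_finrank hσ, ← Module.finrank_mul_finrank F T V] at h
  exact Nat.le_of_mul_le_mul_right (h.trans (Nat.mul_le_mul_left _ hV)) (orderOf_pos σ)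

end CyclicGalois

/-! ### The invariant `m` and the Schur index over an extension -/

section Index

open IntermediateField

variable {F K E L : Type*} [Field F] [Field K] [Field E] [Field L] [Algebra F K] [Algebra F E]
  [Algebra F L] [Algebra E L] [Algebra K L] [IsScalarTower F K L] [IsScalarTower F E L]
  [FiniteDimensional F K] [IsGalois F K] {σ : K ≃ₐ[F] K}

omit [FiniteDimensional F K] [IsGalois F K] [IsScalarTower F K L] in
theorem isScalarTower_intermediateField (T : IntermediateField E L) : IsScalarTower F T L :=
  IsScalarTower.of_algebraMap_eq fun _ => rfl

theorem exists_finrank_top_eq {p a m : ℕ} (hp : p.Prime) [FiniteDimensional E L] [IsGalois E L]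
    (ha : Module.finrank E L = p ^ a) (hm : m ≤ a) :
    ∃ T : IntermediateField E L, Module.finrank T L = p ^ m ∧
      Module.finrank E T = p ^ (a - m) := by
  have : Fact p.Prime := ⟨hp⟩
  obtain ⟨H, hH⟩ := Sylow.exists_subgroup_card_pow_prime (G := L ≃ₐ[E] L) p (n := m)
    (by rw [IsGalois.card_aut_eq_finrank, ha]; exact pow_dvd_pow p hm)
  have h1 : Module.finrank (fixedField H) L = p ^ m := by
    rw [IntermediateField.finrank_fixedField_eq_card, hH]
  refine ⟨fixedField H, h1, ?_⟩
  have h2 := Module.finrank_mul_finrank E (fixedField H) L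
  rw [h1, ha, ← Nat.sub_add_cancel hm, pow_add] at h2
  simpa using Nat.eq_of_mul_eq_mul_right (pow_pos hp.pos m) h2

/-- If `ξ` is a `p ^ m`-th power in an extension `E` of degree at most `p ^ m`, with `m < n`, then
`ξ` is a norm from `L = KE` to a subextension of codegree `p ^ m`, which must therefore have degree
at least `p ^ n` over `F`; this forces equality everywhere. -/
theorem finrank_eq_of_pow_eq {p n m : ℕ} (hp : p.Prime) (hn : Module.finrank F K = p ^ n)
    (hσ : ∀ τ : K ≃ₐ[F] K, τ ∈ Subgroup.zpowers σ) {ξ : F}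
    (hA : IsDivision (CyclicAlgebra σ ξ)) (hgen : adjoin E (Set.range (algebraMap K L)) = ⊤)
    [FiniteDimensional F E] (hE : Module.finrank F E ≤ p ^ m) (hm : m < n) {z : E}
    (hz : z ^ p ^ m = algebraMap F E ξ) :
    Module.finrank E L = p ^ n ∧ Module.finrank F E = p ^ m := by
  obtain ⟨_, _⟩ := isGalois_of_adjoin_range_eq_top F hgen
  obtain ⟨a, han, ha⟩ := (Nat.dvd_prime_pow hp).1
    (hn ▸ finrank_dvd_of_adjoin_range_eq_top (F := F) hgen)
  have ho := orderOf_eq_finrank hσ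
  rcases lt_or_ge a m with hlt | hge
  -- When `[L : E] < p ^ m`, already `E` splits `A`, although its degree is less than `p ^ n`.
  · have hy : Algebra.norm E (algebraMap E L (z ^ p ^ (m - a))) = algebraMap F E ξ := by
      rw [Algebra.norm_algebraMap, ha, ← pow_mul, ← pow_add, Nat.sub_add_cancel hlt.le, hz]
    have h := orderOf_le_finrank_of_norm_eq hσ hA hgen hy
    rw [ho, hn] at h
    exact absurd ((Nat.pow_le_pow_iff_right hp.one_lt).1 (h.trans hE)) (by omega)
  · obtain ⟨T, hT, hT'⟩ := exists_finrank_top_eq hp ha hge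
    have hy : Algebra.norm T (algebraMap T L (algebraMap E T z)) = algebraMap F T ξ := by
      rw [Algebra.norm_algebraMap, hT, ← map_pow, hz, ← IsScalarTower.algebraMap_apply]
    have : FiniteDimensional F T := FiniteDimensional.trans F E T
    have : IsScalarTower F T L := isScalarTower_intermediateField T
    have h := orderOf_le_finrank_of_norm_eq hσ hA (adjoin_intermediateField_eq_top hgen T) hy
    rw [ho, hn, ← Module.finrank_mul_finrank F E T, hT'] at h
    have h2 : p ^ m * p ^ (a - m) = p ^ a := by rw [← pow_add]; congr 1; omega
    have h3 : p ^ n ≤ p ^ a := h.trans ((Nat.mul_le_mul_right _ hE).trans h2.le)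
    obtain rfl : a = n := le_antisymm han ((Nat.pow_le_pow_iff_right hp.one_lt).1 h3)
    refine ⟨ha, le_antisymm hE ?_⟩
    rw [← h2] at h
    exact Nat.le_of_mul_le_mul_right h (pow_pos hp.pos _)

/-- A subextension `T` with `[T : E] = p ^ s` from which `ξ` is a norm has `p ^ n ≤ p ^ (m + s)`, and
`s = n - m` is attained because `z` has norm `ξ`. -/
theorem mInvariant_eq {p n m : ℕ} (hp : p.Prime) (hn : Module.finrank F K = p ^ n)
    (hσ : ∀ τ : K ≃ₐ[F] K, τ ∈ Subgroup.zpowers σ) {ξ : F} (hξ : ξ ≠ 0)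
    (hA : IsDivision (CyclicAlgebra σ ξ)) (hgen : adjoin E (Set.range (algebraMap K L)) = ⊤)
    [FiniteDimensional F E] (hE : Module.finrank F E = p ^ m) (hL : Module.finrank E L = p ^ n)
    (hm : m < n) {z : E} (hz : z ^ p ^ m = algebraMap F E ξ) :
    mInvariant p E L (algebraMap F E ξ) = ((n - m - 1 : ℕ) : WithBot ℕ) := by
  obtain ⟨_, _⟩ := isGalois_of_adjoin_range_eq_top F hgen
  have ho := orderOf_eq_finrank hσ
  rw [mInvariant, if_neg]
  · have hmem : n - m ∈ {s : ℕ | ∃ T : IntermediateField E L,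
        Module.finrank E T = p ^ s ∧ IsNormTo T (algebraMap F E ξ)} := by
      obtain ⟨T, hT, hT'⟩ := exists_finrank_top_eq hp hL hm.le
      have hz0 : z ≠ 0 := by
        rintro rfl
        rw [zero_pow (pow_pos hp.pos m).ne', eq_comm, map_eq_zero] at hz
        exact hξ hz
      refine ⟨T, hT', Units.mk0 (algebraMap E L z) (by simpa using hz0), ?_⟩
      rw [Units.val_mk0, IsScalarTower.algebraMap_apply E T L, Algebra.norm_algebraMap, hT,
        ← map_pow, hz]
    congr 2
    refine le_antisymm (Nat.sInf_le hmem) (le_csInf ⟨_, hmem⟩ ?_)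
    rintro s ⟨T, hT, y, hy⟩
    rw [← IsScalarTower.algebraMap_apply] at hy
    have : FiniteDimensional F T := FiniteDimensional.trans F E T
    have : IsScalarTower F T L := isScalarTower_intermediateField T
    have h := orderOf_le_finrank_of_norm_eq hσ hA (adjoin_intermediateField_eq_top hgen T) hy
    rw [ho, hn, ← Module.finrank_mul_finrank F E T, hT, hE, ← pow_add,
      Nat.pow_le_pow_iff_right hp.one_lt] at h
    omega
  · rintro ⟨y, hy⟩
    have h := orderOf_le_finrank_of_norm_eq hσ hA hgen hy
    rw [ho, hn, hE, Nat.pow_le_pow_iff_right hp.one_lt] at h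
    omega

/-- The index is pinned between the simple module of `E ⊗ A`, which is large because `A` is a division
algebra, and a small module coming from a subextension from which `ξ` is a norm. -/
theorem schurIndex_eq {p n m : ℕ} (hp : p.Prime) (hn : Module.finrank F K = p ^ n)
    (hσ : ∀ τ : K ≃ₐ[F] K, τ ∈ Subgroup.zpowers σ) {ξ : F}
    (hA : IsDivision (CyclicAlgebra σ ξ)) (hgen : adjoin E (Set.range (algebraMap K L)) = ⊤)
    [FiniteDimensional F E] (hE : Module.finrank F E = p ^ m) (hL : Module.finrank E L = p ^ n)
    (hm : m < n) {z : E} (hz : z ^ p ^ m = algebraMap F E ξ) :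
    schurIndex E (E ⊗[F] CyclicAlgebra σ ξ) = p ^ (n - m) := by
  obtain ⟨_, _⟩ := isGalois_of_adjoin_range_eq_top F hgen
  have ho := orderOf_eq_finrank hσ
  have hsimple : IsSimpleRing (E ⊗[F] CyclicAlgebra σ ξ) := isSimpleRing_tensorProduct hA
    (CyclicAlgebra.exists_algebraMap_eq_of_forall_commute hσ)
  have : IsArtinianRing (E ⊗[F] CyclicAlgebra σ ξ) := IsArtinianRing.of_finite E _
  have hdim : Module.finrank F (CyclicAlgebra σ ξ) = (p ^ n) ^ 2 := by
    rw [CyclicAlgebra.finrank_eq, ho, hn, sq]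
  -- A splitting subfield of codegree `p ^ m` bounds the index from above.
  obtain ⟨T, hT, hT'⟩ := exists_finrank_top_eq hp hL hm.le
  have hy : Algebra.norm T (algebraMap T L (algebraMap E T z)) = algebraMap F T ξ := by
    rw [Algebra.norm_algebraMap, hT, ← map_pow, hz, ← IsScalarTower.algebraMap_apply]
  have : IsScalarTower F T L := isScalarTower_intermediateField T
  obtain ⟨V, _, _, hV, ⟨φ⟩⟩ := exists_representation_of_norm_eq hσ
    (adjoin_intermediateField_eq_top hgen T) hy
  have : FiniteDimensional E V := FiniteDimensional.trans E T V
  let Φ : E ⊗[F] CyclicAlgebra σ ξ →ₐ[E] Module.End E V :=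
    Algebra.TensorProduct.lift (Algebra.ofId E _) ((endRestrictScalars F E).comp φ)
      fun c x => Algebra.commutes c _
  have hVE : Module.finrank E V ≤ p ^ (n - m) * p ^ n := by
    rw [← Module.finrank_mul_finrank E T V, hT', ← hn, ← ho]
    exact Nat.mul_le_mul_left _ hV
  -- The two bounds fix the dimension of the simple module, hence `s` and the dimension of `D`.
  have key : ∀ (s : ℕ) (D : Type _) [DivisionRing D] [Algebra E D], s ≠ 0 →
      (E ⊗[F] CyclicAlgebra σ ξ ≃ₐ[E] Matrix (Fin s) (Fin s) D) →
      FiniteDimensional E D → Module.finrank E D = (p ^ (n - m)) ^ 2 := by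
    intro s D _ _ hs e _
    have h1 : s * s * Module.finrank E D = (p ^ n) ^ 2 := by
      rw [← hdim, ← Module.finrank_baseChange (R := E) (S := F), e.toLinearEquiv.finrank_eq,
        Module.finrank_matrix]
      simp
    have h2 := Matrix.mul_finrank_le_of_algHom (Φ.comp e.symm.toAlgHom)
    have h3 := Matrix.finrank_le_of_algHom_isDivision hs hA e.toAlgHom
    have h4 : p ^ n = p ^ (n - m) * p ^ m := by rw [← pow_add]; congr 1; omega
    rw [hdim, hE] at h3
    have hpm := pow_pos hp.pos m
    have hpn := pow_pos hp.pos n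
    have h5 : s * Module.finrank E D = p ^ (n - m) * p ^ n := by
      refine le_antisymm (h2.trans hVE) (Nat.le_of_mul_le_mul_left (h3.trans' ?_) hpm)
      rw [sq]; nth_rw 2 [h4]; apply le_of_eq; ring
    have h6 : s = p ^ m := by
      rw [mul_assoc, h5, sq, ← mul_assoc] at h1
      have := Nat.eq_of_mul_eq_mul_right hpn h1
      rw [h4, mul_comm] at this
      exact Nat.eq_of_mul_eq_mul_left (pow_pos hp.pos _) this
    rw [h6, h4, ← mul_assoc, mul_comm] at h5
    rw [Nat.eq_of_mul_eq_mul_right hpm h5, sq]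
  have hfin : ∀ (s : ℕ) (D : Type _) [DivisionRing D] [Algebra E D], s ≠ 0 →
      (E ⊗[F] CyclicAlgebra σ ξ ≃ₐ[E] Matrix (Fin s) (Fin s) D) → FiniteDimensional E D := by
    intro s D _ _ hs e
    have : NeZero s := ⟨hs⟩
    have := Module.Finite.equiv e.toLinearEquiv
    exact Module.Finite.of_surjective (Matrix.entryLinearMap E D (0 : Fin s) (0 : Fin s))
      fun d => ⟨Matrix.of fun _ _ => d, rfl⟩
  obtain ⟨s, hs, D, _, _, ⟨e⟩⟩ :=
    IsSimpleRing.exists_algEquiv_matrix_divisionRing E (E ⊗[F] CyclicAlgebra σ ξ)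
  have hmem := key s D hs.ne e (hfin s D hs.ne e)
  rw [schurIndex]
  refine le_antisymm (Nat.sInf_le ⟨s, D, _, _, hs.ne, ⟨e⟩, hmem⟩)
    (le_csInf ⟨_, s, D, _, _, hs.ne, ⟨e⟩, hmem⟩ ?_)
  rintro d ⟨s', D', _, _, hs', ⟨e'⟩, hd⟩
  rw [key s' D' hs' e' (hfin s' D' hs' e')] at hd
  exact (Nat.pow_left_injective two_ne_zero hd).le

end Index

/-! ### Adjoining roots of unity -/

section RootsOfUnity

open IntermediateField

variable {F Ω : Type*} [Field F] [Field Ω] [Algebra F Ω] {p i : ℕ} {ξ : F} {ζ : Ω}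

/-- As `ζ ^ p ^ (i - 1)` is a power of `ξ`, it lies in `F`. -/
theorem IsPrimitiveRoot.finrank_adjoin_le (hp : p.Prime) (hi : 1 ≤ i) (hξ : IsPrimitiveRoot ξ p)
    (hζ : IsPrimitiveRoot ζ (p ^ i)) :
    FiniteDimensional F (adjoin F {ζ}) ∧ Module.finrank F (adjoin F {ζ}) ≤ p ^ (i - 1) := by
  have : NeZero p := ⟨hp.ne_zero⟩
  have hq : 0 < p ^ (i - 1) := pow_pos hp.pos _
  have h1 : (ζ ^ p ^ (i - 1)) ^ p = 1 := by
    rw [← pow_mul, ← pow_succ, Nat.sub_add_cancel hi, hζ.pow_eq_one]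
  obtain ⟨c, -, hc⟩ :=
    (hξ.map_of_injective (algebraMap F Ω).injective).eq_pow_of_pow_eq_one h1
  have hmonic := Polynomial.monic_X_pow_sub_C (ξ ^ c) hq.ne'
  have hroot : Polynomial.aeval ζ (Polynomial.X ^ p ^ (i - 1) - Polynomial.C (ξ ^ c)) = 0 := by
    simp [← hc]
  have hint : IsIntegral F ζ := ⟨_, hmonic, hroot⟩
  refine ⟨adjoin.finiteDimensional hint, ?_⟩
  rw [adjoin.finrank hint]
  exact (Polynomial.natDegree_le_natDegree (minpoly.min F ζ hmonic hroot)).trans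
    Polynomial.natDegree_X_pow_sub_C.le

theorem IsPrimitiveRoot.exists_pow_eq_algebraMap (hp : p.Prime) (hi : 1 ≤ i)
    (hξ : IsPrimitiveRoot ξ p) (hζ : IsPrimitiveRoot ζ (p ^ i)) :
    ∃ z : adjoin F {ζ}, z ^ p ^ (i - 1) = algebraMap F (adjoin F {ζ}) ξ := by
  have : NeZero p := ⟨hp.ne_zero⟩
  have h1 : IsPrimitiveRoot (ζ ^ p ^ (i - 1)) p :=
    hζ.pow (pow_pos hp.pos _) (by rw [← pow_succ, Nat.sub_add_cancel hi])
  obtain ⟨c, -, hc⟩ := h1.eq_pow_of_pow_eq_one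
    (hξ.map_of_injective (algebraMap F Ω).injective).pow_eq_one
  refine ⟨⟨ζ, mem_adjoin_simple_self F ζ⟩ ^ c, Subtype.ext ?_⟩
  rw [← pow_mul, mul_comm, pow_mul]
  exact hc

end RootsOfUnity

section Compositum

open IntermediateField

variable (F K : Type*) {Ω : Type*} [Field F] [Field K] [Field Ω] [Algebra F K] [Algebra F Ω]
  [Algebra K Ω] [IsScalarTower F K Ω] (z : Ω)

/-- The inclusion of `K` in `K(z)`. -/
noncomputable instance : Algebra K (adjoinOver F K z) :=
  ((algebraMap K Ω).codRestrict (adjoinOver F K z).toSubring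
    fun d => (adjoin K {z}).algebraMap_mem d).toAlgebra

instance : IsScalarTower F K (adjoinOver F K z) := IsScalarTower.of_algebraMap_eq fun c =>
  Subtype.ext (IsScalarTower.algebraMap_apply F K Ω c)

instance : IsScalarTower F (adjoin F {z}) (adjoinOver F K z) :=
  IsScalarTower.of_algebraMap_eq fun _ => rfl

variable {K z} in
/-- The field `K(z)` is contained in every subfield of `Ω` containing `K` and `z`. -/
theorem mem_of_mem_adjoinOver {E : Type*} [Field E] [Algebra E Ω] (S : IntermediateField E Ω)
    (hK : ∀ d : K, algebraMap K Ω d ∈ S) (hz : z ∈ S) {x : Ω} (hx : x ∈ adjoinOver F K z) :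
    x ∈ S := by
  have h : adjoin K {z} ≤ S.toSubfield.toIntermediateField hK := by
    rw [adjoin_simple_le_iff]; exact hz
  exact h hx

theorem adjoin_range_adjoinOver :
    adjoin (adjoin F {z}) (Set.range (algebraMap K (adjoinOver F K z))) = ⊤ := by
  rw [eq_top_iff]
  intro x _
  have hx : (x : Ω) ∈ (adjoin (adjoin F {z})
      (Set.range (algebraMap K (adjoinOver F K z)))).map (adjoinOver F K z).val := by
    refine mem_of_mem_adjoinOver F _ (fun d => ?_) ?_ x.2
    · exact ⟨_, subset_adjoin _ _ ⟨d, rfl⟩, rfl⟩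
    · exact IntermediateField.algebraMap_mem _ (⟨z, mem_adjoin_simple_self F z⟩ : adjoin F {z})
  obtain ⟨y, hy, hyx⟩ := hx
  rwa [← Subtype.ext hyx]

/-- If `F(w) ⊆ F(z)` and `[K(w) : F(w)] = [K(z) : F(z)]`, then `K(w)` and `F(z)` are linearly
disjoint over `F(w)`, as their compositum contains `K(z)` and so has the largest possible
degree. -/
theorem linearDisjoint_adjoinOver {w z : Ω} (h : adjoin F {w} ≤ adjoin F {z})
    [FiniteDimensional F (adjoin F {z})] [FiniteDimensional (adjoin F {w}) (adjoinOver F K w)]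
    [FiniteDimensional (adjoin F {z}) (adjoinOver F K z)]
    (heq : Module.finrank (adjoin F {w}) (adjoinOver F K w) =
      Module.finrank (adjoin F {z}) (adjoinOver F K z)) :
    (adjoinOver F K w).LinearDisjoint (extendScalars h) := by
  have h0 : Module.Finite F (extendScalars h) := ‹FiniteDimensional F (adjoin F {z})›
  have : FiniteDimensional (adjoin F {w}) (extendScalars h) :=
    Module.Finite.of_restrictScalars_finite F _ _
  have hw : FiniteDimensional F (adjoin F {w}) :=
    FiniteDimensional.of_injective (inclusion h).toLinearMap (inclusion h).injective
  set S := adjoinOver F K w ⊔ extendScalars h with hS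
  have : FiniteDimensional F S := FiniteDimensional.trans F (adjoin F {w}) S
  refine LinearDisjoint.of_finrank_sup (le_antisymm (finrank_sup_le _ _) ?_)
  have hle : ∀ x ∈ adjoinOver F K z, x ∈ S := fun x hx => mem_of_mem_adjoinOver F S
    (fun d => (le_sup_left : adjoinOver F K w ≤ S) ((adjoin K {w}).algebraMap_mem d))
    ((le_sup_right : extendScalars h ≤ S) (mem_adjoin_simple_self F z)) hx
  let f : adjoinOver F K z →ₗ[F] S :=
    { toFun := fun x => ⟨x, hle x x.2⟩
      map_add' := fun _ _ => rfl
      map_smul' := fun _ _ => rfl }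
  have hf : Function.Injective f := fun x y hxy =>
    Subtype.ext (congrArg (fun v : S => (v : Ω)) hxy)
  have h1 := LinearMap.finrank_le_finrank_of_injective hf
  -- Over fields the freeness hypotheses of `Module.finrank_mul_finrank` hold, but the search for
  -- them is slow for these intermediate fields.
  have : Module.Free (adjoin F {w}) (extendScalars h) := Module.Free.of_divisionRing _ _
  have : Module.Free (adjoin F {w}) S := Module.Free.of_divisionRing _ _
  have : Module.Free (adjoin F {z}) (adjoinOver F K z) := Module.Free.of_divisionRing _ _
  have h2 : Module.finrank F (adjoin F {w}) * Module.finrank (adjoin F {w}) (extendScalars h) =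
      Module.finrank F (adjoin F {z}) :=
    Module.finrank_mul_finrank F (adjoin F {w}) (extendScalars h)
  rw [← Module.finrank_mul_finrank F (adjoin F {z}) (adjoinOver F K z), ← h2, ← heq,
    ← Module.finrank_mul_finrank F (adjoin F {w}) S, mul_assoc] at h1
  rw [mul_comm]
  exact Nat.le_of_mul_le_mul_left h1 Module.finrank_pos

end Compositum

theorem proposition1 (p n : ℕ) (hp : p.Prime)
    (F K Ω : Type*) [Field F] [Field K] [Field Ω] [Algebra F K] [Algebra F Ω] [Algebra K Ω]
    [IsScalarTower F K Ω] [FiniteDimensional F K] [IsGalois F K]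
    (hdeg : Module.finrank F K = p ^ n)
    (σ : K ≃ₐ[F] K) (hσ : ∀ τ : K ≃ₐ[F] K, τ ∈ Subgroup.zpowers σ)
    (ξ : F) (hξ : IsPrimitiveRoot ξ p)
    (hA : IsDivision (CyclicAlgebra σ ξ))
    (ζ : ℕ → Ω) (hζ : ∀ i, 1 ≤ i → i ≤ n → IsPrimitiveRoot (ζ i) (p ^ i)) :
    ∀ i, 1 ≤ i → i ≤ n →
      (∃ h : IntermediateField.adjoin F {ζ i} ≤ IntermediateField.adjoin F {ζ n},
        (adjoinOver F K (ζ i)).LinearDisjoint (IntermediateField.extendScalars h)) ∧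
      (IsGalois (IntermediateField.adjoin F {ζ i}) (adjoinOver F K (ζ i)) ∧
        IsCyclic (adjoinOver F K (ζ i) ≃ₐ[IntermediateField.adjoin F {ζ i}]
          adjoinOver F K (ζ i)) ∧
        Module.finrank (IntermediateField.adjoin F {ζ i}) (adjoinOver F K (ζ i)) = p ^ n) ∧
      ∃ m : ℕ,
        mInvariant p (IntermediateField.adjoin F {ζ i}) (adjoinOver F K (ζ i))
          (algebraMap F (IntermediateField.adjoin F {ζ i}) ξ) = (m : WithBot ℕ) ∧
        schurIndex (IntermediateField.adjoin F {ζ i})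
          (IntermediateField.adjoin F {ζ i} ⊗[F] CyclicAlgebra σ ξ) = p ^ (m + 1) ∧
        p ^ (m + 1) = p ^ (n - i + 1) := by
  intro i hi hin
  have hgen := adjoin_range_adjoinOver F K (Ω := Ω)
  have hfin : ∀ j, 1 ≤ j → j ≤ n →
      FiniteDimensional F (IntermediateField.adjoin F {ζ j}) ∧
      Module.finrank (IntermediateField.adjoin F {ζ j}) (adjoinOver F K (ζ j)) = p ^ n ∧
      Module.finrank F (IntermediateField.adjoin F {ζ j}) = p ^ (j - 1) := by
    intro j hj hjn
    obtain ⟨hfd, hle⟩ := IsPrimitiveRoot.finrank_adjoin_le hp hj hξ (hζ j hj hjn)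
    obtain ⟨z, hz⟩ := IsPrimitiveRoot.exists_pow_eq_algebraMap hp hj hξ (hζ j hj hjn)
    exact ⟨hfd, finrank_eq_of_pow_eq hp hdeg hσ hA (hgen _) hle (by omega) hz⟩
  obtain ⟨_, hLi, hFi⟩ := hfin i hi hin
  obtain ⟨_, hLn, -⟩ := hfin n (hi.trans hin) le_rfl
  obtain ⟨z, hz⟩ := IsPrimitiveRoot.exists_pow_eq_algebraMap hp hi hξ (hζ i hi hin)
  obtain ⟨hgal, _⟩ := isGalois_of_adjoin_range_eq_top F (hgen (ζ i))
  obtain ⟨_, _⟩ := isGalois_of_adjoin_range_eq_top F (hgen (ζ n))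
  have hle : IntermediateField.adjoin F {ζ i} ≤ IntermediateField.adjoin F {ζ n} := by
    have : NeZero (p ^ n) := ⟨(pow_pos hp.pos n).ne'⟩
    obtain ⟨c, -, hc⟩ := (hζ n (hi.trans hin) le_rfl).eq_pow_of_pow_eq_one
      (((hζ i hi hin).pow_eq_one_iff_dvd _).2 (pow_dvd_pow p hin))
    rw [IntermediateField.adjoin_simple_le_iff, ← hc]
    exact pow_mem (IntermediateField.mem_adjoin_simple_self F (ζ n)) c
  have : IsCyclic (K ≃ₐ[F] K) := ⟨σ, hσ⟩
  have hexp : n - i + 1 = n - (i - 1) := by omega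
  refine ⟨⟨hle, linearDisjoint_adjoinOver F K hle (hLi.trans hLn.symm)⟩, ⟨hgal,
    isCyclic_of_injective _ (restrictGal_injective (F := F) (hgen (ζ i))), hLi⟩, n - i, ?_, ?_, rfl⟩
  · rw [mInvariant_eq hp hdeg hσ (hξ.ne_zero hp.ne_zero) hA (hgen _) hFi hLi (by omega) hz]
    congr 1; omega
  · rw [hexp]
    exact schurIndex_eq hp hdeg hσ hA (hgen _) hFi hLi (by omega) hz
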